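/- Let $\mathcal{A}$ be an abelian category with enough injectives, and let $D^b(\mathcal{A})\subset D(\mathcal{A})$ be its bounded derived category, the full subcategory of the derived category on the objects with bounded cohomology. Let $FAb$ be the category of abelian groups $A$ equipped with a decreasing filtration $(F^pA)_{p\in\mathbf{Z}}$ by subgroups, with the homomorphisms that respect the filtrations as morphisms. Then for all $K, L \in D^b(\mathcal{A})$ there is a decreasing filtration $(F^p)_{p\in\mathbf{Z}}$ on $\mathrm{Hom}_{D(\mathcal{A})}(K, L)$ which is natural, in the sense that it arises from a functor $D^b(\mathcal{A})^{opp} \times D^b(\mathcal{A}) \to FAb$ whose composition with the forgetful functor from $FAb$ to abelian groups is the functor $(K,L)\mapsto \mathrm{Hom}_{D(\mathcal{A})}(K,L)$, and which satisfies, for all $K, L, M \in D^b(\mathcal{A})$ and all $p,q\in\mathbf{Z}$: 1. $F^0\mathrm{Hom}_{D(\mathcal{A})}(K, L) = \mathrm{Hom}_{D(\mathcal{A})}(K, L)$, and $F^r\mathrm{Hom}_{D(\mathcal{A})}(K, L) = 0$ for all sufficiently large $r$ (depending on $K$ and $L$). 2. If $f \in F^p\mathrm{Hom}_{D(\mathcal{A})}(K,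 L)$ and $g \in F^q \mathrm{Hom}_{D(\mathcal{A})} (L, M)$, then $g \circ f \in F^{p+q}\mathrm{Hom}_{D(\mathcal{A})}(K, M)$. 3. The abelian group $F^p\mathrm{Hom}_{D(\mathcal{A})}(K, L)/F^{p+1}\mathrm{Hom}_{D(\mathcal{A})}(K, L)$ is a subquotient of (that is, isomorphic to a quotient of a subgroup of) $\prod_{n \in \mathbf{Z}}\mathrm{Ext}^p_{\mathcal{A}} (H^n(K), H^{n-p}(L))$, where $\mathrm{Ext}^p_{\mathcal{A}} = 0$ for $p<0$. 4. $F^1\mathrm{Hom}_{D(\mathcal{A})}(K, L) = \{\varphi \in \mathrm{Hom}_{D(\mathcal{A})} (K, L) : H^n(\varphi) = 0 \text{ for all } n \in \mathbf{Z}\}$. -/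

import Mathlib

open CategoryTheory Opposite

universe w' w v u

/-- An abelian group with a decreasing filtration by subgroups indexed by `ℤ`. -/
structure FilteredAb : Type (w + 1) where
  carrier : Type w
  [group : AddCommGroup carrier]
  /-- the `p`-th step of the filtration -/
  fil : ℤ → AddSubgroup carrier
  antitone_fil : Antitone fil

namespace FilteredAb

attribute [instance] FilteredAb.group

/-- Morphisms of filtered abelian groups: homomorphisms `φ` with `φ (F^p A) ⊆ F^p B`. -/
@[ext]
structure Hom (A B : FilteredAb.{w}) : Type w where
  hom : A.carrier →+ B.carrier
  map_mem : ∀ (p : ℤ) (x : A.carrier), x ∈ A.fil p → hom x ∈ B.fil p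

instance : Category.{w} FilteredAb.{w} where
  Hom A B := Hom A B
  id A := ⟨AddMonoidHom.id A.carrier, fun _ _ hx => hx⟩
  comp f g := ⟨g.hom.comp f.hom, fun p x hx => g.map_mem p _ (f.map_mem p x hx)⟩

/-- The functor from filtered abelian groups to abelian groups that forgets the filtration. -/
def forgetFiltration : FilteredAb.{w} ⥤ AddCommGrpCat.{w} where
  obj A := AddCommGrpCat.of A.carrier
  map f := AddCommGrpCat.ofHom (Hom.hom f)
  map_id _ := rfl
  map_comp _ _ := rfl

end FilteredAb

/-- `G` is a subquotient of `H`: it is isomorphic to a quotient of a subgroup of `H`. -/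
def IsAddSubquotient (G : Type*) [AddCommGroup G] (H : Type*) [AddCommGroup H] : Prop :=
  ∃ (S : AddSubgroup H) (T : AddSubgroup S), Nonempty (G ≃+ S ⧸ T)

section

variable (C : Type u) [Category.{v} C] [Abelian C] [HasDerivedCategory.{w} C]

/-- The functor `D^b(C)ᵒᵖ × D^b(C) ⥤ Ab`, `(K, L) ↦ Hom_{D(C)}(K, L)`. -/
noncomputable def boundedHomFunctor :
    (DerivedCategory.Bounded C)ᵒᵖ × DerivedCategory.Bounded C ⥤ AddCommGrpCat.{w} :=
  (DerivedCategory.Bounded.ι (C := C)).op.prod (DerivedCategory.Bounded.ι (C := C)) ⋙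
    Functor.uncurry.obj preadditiveCoyoneda

variable {C}

/-- For a functor `Φ` to filtered abelian groups which lifts the `Hom`-functor, the identification
of the abelian group underlying `Φ (K, L)` with `Hom_{D(C)}(K, L)`. -/
noncomputable def homIdentification
    (Φ : (DerivedCategory.Bounded C)ᵒᵖ × DerivedCategory.Bounded C ⥤ FilteredAb.{w})
    (e : Φ ⋙ FilteredAb.forgetFiltration ≅ boundedHomFunctor C)
    (K L : DerivedCategory.Bounded C) : (Φ.obj (op K, L)).carrier →+ (K.obj ⟶ L.obj) :=
  (e.hom.app (op K, L)).hom

/-- The filtration on `Hom_{D(C)}(K, L)` given by a functor to filtered abelian groups which lifts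
the `Hom`-functor: the `p`-th step is the `p`-th step of the filtration of `Φ (K, L)`, viewed in
`Hom_{D(C)}(K, L)`. -/
noncomputable def homFiltration
    (Φ : (DerivedCategory.Bounded C)ᵒᵖ × DerivedCategory.Bounded C ⥤ FilteredAb.{w})
    (e : Φ ⋙ FilteredAb.forgetFiltration ≅ boundedHomFunctor C)
    (K L : DerivedCategory.Bounded C) (p : ℤ) : AddSubgroup (K.obj ⟶ L.obj) :=
  ((Φ.obj (op K, L)).fil p).map (homIdentification Φ e K L)

end

/-! Ghosts, the morphisms vanishing on cohomology, form a two-sided ideal, and F^p is its p-th power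
(everything for p ≤ 0). Naturality, multiplicativity and the description of F^1 are then formal.

For the rest, choose L → E injective on cohomology, with E a complex of injectives with zero
differential. Ghosts into E are zero, so every ghost into L factors through the fibre L₁ → L, itself
a ghost (`nonempty_ghostCover`), and 0 → H^n(L) → H^n(E) → H^{n+1}(L₁) → 0 is exact. Iterating p
times gives P → L through which all of F^p factors (`exists_ghostPow_cover`). Products of the
extension classes give κ in Ext^p(H^n(P), H^{n-p}(L)), and any x : K → P that pulls every κ back to
0 composes into F^{p+1}. So F^p/F^{p+1} is a quotient of the image of Hom(K, P) in the product of
Ext groups. Each iteration also raises the lower bound on cohomology by one, whence Hom(K, P) = 0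
for large p. -/

namespace CochainComplex

/-! ### Complexes of injectives with zero differential -/

open HomologicalComplex Limits

variable {C : Type u} [Category.{v} C] [Abelian C]

/-- A cochain complex of injective objects all of whose differentials are zero. -/
structure IsInjectiveWithZeroDifferential (E : CochainComplex C ℤ) : Prop where
  injective (n : ℤ) : Injective (E.X n)
  d_eq_zero (i j : ℤ) : E.d i j = 0

namespace IsInjectiveWithZeroDifferential

variable {E : CochainComplex C ℤ} (hE : E.IsInjectiveWithZeroDifferential)

include hE

lemma shift (a : ℤ) : (E⟦a⟧).IsInjectiveWithZeroDifferential where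
  injective n := hE.injective (n + a)
  d_eq_zero i j := by
    rw [shiftFunctor_obj_d', hE.d_eq_zero]
    exact smul_zero (M := ℤ) _

lemma isIso_pOpcycles (n : ℤ) : IsIso (E.pOpcycles n) :=
  E.isIso_pOpcycles (n - 1) n (by simp) (hE.d_eq_zero _ _)

lemma isIso_homologyι (n : ℤ) : IsIso (E.homologyι n) :=
  E.isIso_homologyι n (n + 1) (by simp) (hE.d_eq_zero _ _)

lemma injective_opcycles (n : ℤ) : Injective (E.opcycles n) :=
  have := hE.isIso_pOpcycles n
  Injective.of_iso (asIso (E.pOpcycles n)) (hE.injective n)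

/-- The homology of `E` is `E.X n` in degree `n`. -/
noncomputable def homologyIso (n : ℤ) : E.homology n ≅ E.X n :=
  have := hE.isIso_pOpcycles n
  have := hE.isIso_homologyι n
  asIso (E.homologyι n) ≪≫ (asIso (E.pOpcycles n)).symm

lemma exists_homologyMap_eq {K : CochainComplex C ℤ}
    (α : ∀ n, K.homology n ⟶ E.homology n) :
    ∃ φ : K ⟶ E, ∀ n, homologyMap φ n = α n := by
  have := hE.isIso_pOpcycles
  have := hE.injective_opcycles
  let β (n : ℤ) : K.opcycles n ⟶ E.opcycles n :=
    Injective.factorThru (α n ≫ E.homologyι n) (K.homologyι n)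
  have hβ (n : ℤ) : K.homologyι n ≫ β n = α n ≫ E.homologyι n := Injective.comp_factorThru _ _
  let φ : K ⟶ E :=
    { f n := K.pOpcycles n ≫ β n ≫ inv (E.pOpcycles n)
      comm' i j _ := by simp [hE.d_eq_zero] }
  have hφ (n : ℤ) : opcyclesMap φ n = β n := by
    rw [← cancel_epi (K.pOpcycles n), p_opcyclesMap]
    simp [φ]
  exact ⟨φ, fun n ↦ by
    rw [← cancel_mono (E.homologyι n), homologyι_naturality, hφ, hβ]⟩

/-- Vanishing on homology makes `φ` factor through the image of the opcycles in the next term, and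
injectivity extends it to that term. As `E` has no differential, this extension alone is the
homotopy. -/
lemma nonempty_homotopy_zero {K : CochainComplex C ℤ} (φ : K ⟶ E)
    (hφ : ∀ n, homologyMap φ n = 0) : Nonempty (Homotopy φ 0) := by
  have := hE.isIso_pOpcycles
  have := hE.injective_opcycles
  have h (n : ℤ) : ∃ s : K.X (n + 1) ⟶ E.X n, K.d n (n + 1) ≫ s = φ.f n := by
    have ex : (ShortComplex.mk _ _ (K.homologyι_comp_fromOpcycles n (n + 1))).Exact :=
      ShortComplex.exact_of_f_is_kernel _ (K.homologyIsKernel n (n + 1) (by simp))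
    have hz : K.homologyι n ≫ opcyclesMap φ n = 0 := by
      rw [← homologyι_naturality, hφ, zero_comp]
    refine ⟨ex.descToInjective (opcyclesMap φ n) hz ≫ inv (E.pOpcycles n), ?_⟩
    have h₁ : K.fromOpcycles n (n + 1) ≫ ex.descToInjective (opcyclesMap φ n) hz =
        opcyclesMap φ n := ex.comp_descToInjective _ _
    rw [← p_fromOpcycles, Category.assoc, reassoc_of% h₁, p_opcyclesMap_assoc]
    simp
  choose s hs using h
  refine ⟨{
    hom i j := if hij : j + 1 = i then eqToHom (by rw [hij]) ≫ s j else 0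
    zero i j hij := dif_neg hij
    comm n := ?_ }⟩
  rw [dNext_eq _ (show (ComplexShape.up ℤ).Rel n (n + 1) by simp), prevD_eq _
    (show (ComplexShape.up ℤ).Rel (n - 1) n by simp)]
  simp [hE.d_eq_zero, hs]

lemma isKInjective : E.IsKInjective where
  nonempty_homotopy_zero f hK := hE.nonempty_homotopy_zero f fun n ↦
    (hK n).isZero_homology.eq_of_src _ _

end IsInjectiveWithZeroDifferential

end CochainComplex

/-! ### Ghosts and split injective objects -/

namespace DerivedCategory

open HomologicalComplex Limits Pretriangulated

variable {C : Type u} [Category.{v} C] [Abelian C] [HasDerivedCategory.{w} C]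

/-- The homology of the image in the derived category of a cochain complex. -/
noncomputable def homologyObjQIso (K : CochainComplex C ℤ) (n : ℤ) :
    (homologyFunctor C n).obj (Q.obj K) ≅ K.homology n :=
  (homologyFunctorFactors C n).app K

lemma homologyObjQIso_hom_naturality {K L : CochainComplex C ℤ} (φ : K ⟶ L) (n : ℤ) :
    (homologyFunctor C n).map (Q.map φ) ≫ (homologyObjQIso L n).hom =
      (homologyObjQIso K n).hom ≫ homologyMap φ n :=
  homologyFunctorFactors_hom_naturality φ n

/-- A morphism in the derived category is a ghost if it is zero on cohomology. -/
def IsGhost {K L : DerivedCategory C} (f : K ⟶ L) : Prop :=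
  ∀ n : ℤ, (homologyFunctor C n).map f = 0

lemma IsGhost.comp_left {K L M : DerivedCategory C} {g : L ⟶ M} (hg : IsGhost g) (f : K ⟶ L) :
    IsGhost (f ≫ g) := fun n ↦ by rw [Functor.map_comp, hg n, comp_zero]

lemma IsGhost.comp_right {K L M : DerivedCategory C} {f : K ⟶ L} (hf : IsGhost f) (g : L ⟶ M) :
    IsGhost (f ≫ g) := fun n ↦ by rw [Functor.map_comp, hf n, zero_comp]

/-- The property of being represented by a complex of injective objects with zero differential. -/
def IsSplitInjective (E : DerivedCategory C) : Prop :=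
  ∃ (I : CochainComplex C ℤ), I.IsInjectiveWithZeroDifferential ∧ Nonempty (E ≅ Q.obj I)

namespace IsSplitInjective

variable {E : DerivedCategory C} (hE : E.IsSplitInjective)

include hE

lemma shift (a : ℤ) : (E⟦a⟧).IsSplitInjective := by
  obtain ⟨I, hI, ⟨e⟩⟩ := hE
  exact ⟨I⟦a⟧, hI.shift a,
    ⟨(shiftFunctor (DerivedCategory C) a).mapIso e ≪≫ ((Q.commShiftIso a).app I).symm⟩⟩

lemma injective_homology (n : ℤ) : Injective ((homologyFunctor C n).obj E) := by
  obtain ⟨I, hI, ⟨e⟩⟩ := hE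
  exact Injective.of_iso ((homologyFunctor C n).mapIso e ≪≫
    homologyObjQIso I n ≪≫ hI.homologyIso n).symm (hI.injective n)

lemma exists_homology_map_eq {K : DerivedCategory C}
    (α : ∀ n, (homologyFunctor C n).obj K ⟶ (homologyFunctor C n).obj E) :
    ∃ f : K ⟶ E, ∀ n, (homologyFunctor C n).map f = α n := by
  obtain ⟨I, hI, ⟨e⟩⟩ := hE
  let e' := Q.objObjPreimageIso K
  obtain ⟨φ, hφ⟩ := hI.exists_homologyMap_eq (K := Q.objPreimage K) fun n ↦
    (homologyObjQIso _ n).inv ≫ (homologyFunctor C n).map e'.hom ≫ α n ≫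
      (homologyFunctor C n).map e.hom ≫ (homologyObjQIso _ n).hom
  refine ⟨e'.inv ≫ Q.map φ ≫ e.inv, fun n ↦ ?_⟩
  have h := homologyObjQIso_hom_naturality φ n
  rw [hφ n, Iso.hom_inv_id_assoc, ← Category.assoc, ← Category.assoc, cancel_mono,
    Category.assoc] at h
  rw [Functor.map_comp, Functor.map_comp, h]
  simp [← Functor.map_comp, ← Functor.map_comp_assoc]

lemma eq_zero_of_isGhost {K : DerivedCategory C} (f : K ⟶ E) (hf : IsGhost f) : f = 0 := by
  obtain ⟨I, hI, ⟨e⟩⟩ := hE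
  have := hI.isKInjective
  let e' := Q.objObjPreimageIso K
  obtain ⟨ψ, hψ⟩ := (CochainComplex.IsKInjective.Qh_map_bijective
    ((HomotopyCategory.quotient _ _).obj (Q.objPreimage K)) I).surjective
      ((quotientCompQhIso C).hom.app _ ≫ e'.hom ≫ f ≫ e.hom ≫ (quotientCompQhIso C).inv.app _)
  obtain ⟨φ, rfl⟩ := (HomotopyCategory.quotient _ _).map_surjective ψ
  have h : Q.map φ = e'.hom ≫ f ≫ e.hom := by
    rw [← cancel_epi ((quotientCompQhIso C).hom.app _), ← quotientCompQhIso_hom_naturality, hψ]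
    simp
  have hφ (n : ℤ) : homologyMap φ n = 0 := by
    rw [← cancel_epi (homologyObjQIso _ n).hom, ← homologyObjQIso_hom_naturality, h, ((hf.comp_right e.hom).comp_left e'.hom) n]
    simp
  obtain ⟨H⟩ := hI.nonempty_homotopy_zero φ hφ
  have hz := Q_map_eq_of_homotopy C H
  rw [h, Functor.map_zero] at hz
  rw [← cancel_epi e'.hom, ← cancel_mono e.hom, Category.assoc, hz]
  simp

end IsSplitInjective

end DerivedCategory

/-! ### Universal ghosts -/

namespace DerivedCategory

open Limits Pretriangulated

variable {C : Type u} [Category.{v} C] [Abelian C] [HasDerivedCategory.{w} C]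

lemma exists_isSplitInjective_hom [EnoughInjectives C] (L : DerivedCategory C) :
    ∃ (E : DerivedCategory C) (j : L ⟶ E), E.IsSplitInjective ∧
      (∀ n, Mono ((homologyFunctor C n).map j)) ∧
      ∀ n, IsZero ((homologyFunctor C n).obj L) → IsZero ((homologyFunctor C n).obj E) := by
  have h (X : C) : ∃ (J : C) (i : X ⟶ J), Injective J ∧ Mono i ∧ (IsZero X → IsZero J) := by
    by_cases hX : IsZero X
    -- `Injective.ι` might embed a zero object in a nonzero one, which would lose the bounds on
    -- cohomology.
    · exact ⟨X, 𝟙 X, hX.injective, inferInstance, id⟩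
    · exact ⟨_, Injective.ι X, inferInstance, inferInstance, fun h ↦ (hX h).elim⟩
  choose J i hJ hi hz using fun n ↦ h ((homologyFunctor C n).obj L)
  let I : CochainComplex C ℤ := { X := J, d := 0 }
  have hI : I.IsInjectiveWithZeroDifferential := ⟨hJ, fun _ _ ↦ rfl⟩
  let e (n : ℤ) : J n ≅ (homologyFunctor C n).obj (Q.obj I) :=
    (hI.homologyIso n).symm ≪≫ (homologyObjQIso I n).symm
  have hQI : (Q.obj I).IsSplitInjective := ⟨I, hI, ⟨Iso.refl _⟩⟩
  obtain ⟨j, hj⟩ := hQI.exists_homology_map_eq (K := L) fun n ↦ i n ≫ (e n).hom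
  refine ⟨Q.obj I, j, hQI, fun n ↦ ?_, fun n hn ↦ (hz n hn).of_iso (e n).symm⟩
  rw [hj]
  infer_instance

/-- A ghost `i : obj ⟶ L` through which all ghosts with target `L` factor, with fibre a split
injective object. -/
structure GhostCover (L : DerivedCategory C) where
  obj : DerivedCategory C
  E : DerivedCategory C
  a : E ⟶ obj
  i : obj ⟶ L
  /-- the connecting homomorphism -/
  δ (n₀ n₁ : ℤ) (h : n₀ + 1 = n₁) : (homologyFunctor C n₀).obj L ⟶ (homologyFunctor C n₁).obj E
  isSplitInjective : E.IsSplitInjective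
  a_i : a ≫ i = 0
  isGhost_i : IsGhost i
  exists_lift {K : DerivedCategory C} (f : K ⟶ L) (hf : IsGhost f) : ∃ g : K ⟶ obj, g ≫ i = f
  δ_a (n₀ n₁ : ℤ) (h : n₀ + 1 = n₁) : δ n₀ n₁ h ≫ (homologyFunctor C n₁).map a = 0
  shortExact (n₀ n₁ : ℤ) (h : n₀ + 1 = n₁) : (ShortComplex.mk _ _ (δ_a n₀ n₁ h)).ShortExact
  isZero (n₀ n₁ : ℤ) (h : n₀ + 1 = n₁) :
    IsZero ((homologyFunctor C n₀).obj L) → IsZero ((homologyFunctor C n₁).obj obj)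

lemma nonempty_ghostCover [EnoughInjectives C] (L : DerivedCategory C) :
    Nonempty L.GhostCover := by
  obtain ⟨E, j, hE, hj, hz⟩ := exists_isSplitInjective_hom L
  obtain ⟨L₁, i, h, hT⟩ := distinguished_cocone_triangle₁ j
  let T := Triangle.mk i j h
  have hT' : T.invRotate ∈ distTriang _ := inv_rot_of_distTriang T hT
  have hi : IsGhost i := fun n ↦ by
    rw [← cancel_mono ((homologyFunctor C n).map j), zero_comp, ← Functor.map_comp]
    have : i ≫ j = 0 := comp_distTriang_mor_zero₁₂ _ hT
    rw [this, Functor.map_zero]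
  have hepi (n : ℤ) : Epi ((homologyFunctor C n).map T.invRotate.mor₁) :=
    (HomologySequence.epi_homologyMap_mor₁_iff _ hT' n).2 (hi n)
  exact ⟨{
    obj := L₁
    -- Rotation gives E[-1] → L₁ → L, whose long exact sequence splits into short ones because `i`
    -- is a ghost.
    E := E⟦(-1 : ℤ)⟧
    a := T.invRotate.mor₁
    i := i
    δ n₀ n₁ h := HomologySequence.δ T.invRotate n₀ n₁ h
    isSplitInjective := hE.shift _
    a_i := comp_distTriang_mor_zero₁₂ _ hT'
    isGhost_i := hi
    exists_lift f hf := by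
      obtain ⟨g, hg⟩ := Triangle.coyoneda_exact₂ _ hT f (hE.eq_zero_of_isGhost _ (hf.comp_right j))
      exact ⟨g, hg.symm⟩
    δ_a n₀ n₁ h := HomologySequence.δ_comp _ hT' n₀ n₁ h
    shortExact n₀ n₁ h :=
      { exact := HomologySequence.exact₁ _ hT' n₀ n₁ h
        mono_f := (HomologySequence.exact₃ _ hT' n₀ n₁ h).mono_g (hi n₀)
        epi_g := hepi n₁ }
    isZero n₀ n₁ h hL :=
      @IsZero.of_epi _ _ _ _ _ _ (hepi n₁) ((hz n₀ hL).of_iso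
        (((homologyFunctor C 0).shiftIso (-1) n₁ n₀ (by lia)).app E)) }⟩

/-! ### Powers of the ghost ideal -/

/-- The subgroup of the morphisms which are sums of composites of `p` ghosts. -/
noncomputable def ghostPow : ℕ → ∀ K L : DerivedCategory C, AddSubgroup (K ⟶ L)
  | 0, _, _ => ⊤
  | p + 1, K, L => AddSubgroup.closure
      {f | ∃ (M : DerivedCategory C) (g : K ⟶ M) (h : M ⟶ L),
        g ∈ ghostPow p K M ∧ IsGhost h ∧ g ≫ h = f}

lemma mem_ghostPow_zero {K L : DerivedCategory C} (f : K ⟶ L) : f ∈ ghostPow 0 K L :=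
  AddSubgroup.mem_top _

lemma comp_mem_ghostPow_succ {K L M : DerivedCategory C} {p : ℕ} {f : K ⟶ L} {g : L ⟶ M}
    (hf : f ∈ ghostPow p K L) (hg : IsGhost g) : f ≫ g ∈ ghostPow (p + 1) K M :=
  AddSubgroup.subset_closure ⟨_, f, g, hf, hg, rfl⟩

lemma ghostPow_succ_le {K L : DerivedCategory C} {p : ℕ} (S : AddSubgroup (K ⟶ L))
    (hS : ∀ (M : DerivedCategory C) (g : K ⟶ M) (h : M ⟶ L),
      g ∈ ghostPow p K M → IsGhost h → g ≫ h ∈ S) :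
    ghostPow (p + 1) K L ≤ S := by
  rw [ghostPow, AddSubgroup.closure_le]
  rintro _ ⟨M, g, h, hg, hh, rfl⟩
  exact hS M g h hg hh

lemma comp_mem_ghostPow_left {p : ℕ} : ∀ {K L M : DerivedCategory C} (k : K ⟶ L) {f : L ⟶ M},
    f ∈ ghostPow p L M → k ≫ f ∈ ghostPow p K M := by
  induction p with
  | zero => exact fun k f _ ↦ mem_ghostPow_zero _
  | succ p hp =>
    intro K L M k f hf
    refine ghostPow_succ_le ((ghostPow (p + 1) K M).comap (Preadditive.leftComp M k))
      (fun N g h hg hh ↦ ?_) hf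
    change k ≫ g ≫ h ∈ ghostPow (p + 1) K M
    rw [← Category.assoc]
    exact comp_mem_ghostPow_succ (hp k hg) hh

lemma comp_mem_ghostPow_right {p : ℕ} {K L M : DerivedCategory C} {f : K ⟶ L} (k : L ⟶ M)
    (hf : f ∈ ghostPow p K L) : f ≫ k ∈ ghostPow p K M := by
  obtain _ | p := p
  · exact mem_ghostPow_zero _
  · refine ghostPow_succ_le ((ghostPow (p + 1) K M).comap (Preadditive.rightComp K k))
      (fun N g h hg hh ↦ ?_) hf
    change (g ≫ h) ≫ k ∈ ghostPow (p + 1) K M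
    rw [Category.assoc]
    exact comp_mem_ghostPow_succ hg (hh.comp_right k)

lemma ghostPow_antitone (K L : DerivedCategory C) : Antitone fun p ↦ ghostPow p K L :=
  antitone_nat_of_succ_le fun _ ↦ ghostPow_succ_le _ fun _ _ h hg _ ↦ comp_mem_ghostPow_right h hg

lemma mem_ghostPow_one_iff {K L : DerivedCategory C} (f : K ⟶ L) :
    f ∈ ghostPow 1 K L ↔ IsGhost f := by
  refine ⟨fun hf ↦ ?_, fun hf ↦ ?_⟩
  · induction hf using AddSubgroup.closure_induction with
    | mem _ hx =>
      obtain ⟨M, g, h, _, hh, rfl⟩ := hx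
      exact hh.comp_left g
    | zero => exact fun n ↦ Functor.map_zero _ _ _
    | add x y _ _ hx hy => exact fun n ↦ by rw [Functor.map_add, hx n, hy n, add_zero]
    | neg x _ hx => exact fun n ↦ by rw [Functor.map_neg, hx n, neg_zero]
  · rw [← Category.id_comp f]
    exact comp_mem_ghostPow_succ (mem_ghostPow_zero _) hf

lemma comp_mem_ghostPow_add {p q : ℕ} : ∀ {K L M : DerivedCategory C} {f : K ⟶ L} {g : L ⟶ M},
    f ∈ ghostPow p K L → g ∈ ghostPow q L M → f ≫ g ∈ ghostPow (p + q) K M := by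
  induction q with
  | zero => exact fun hf _ ↦ comp_mem_ghostPow_right _ hf
  | succ q hq =>
    intro K L M f g hf hg
    refine ghostPow_succ_le ((ghostPow (p + q + 1) K M).comap (Preadditive.leftComp M f))
      (fun N a b ha hb ↦ ?_) hg
    change f ≫ a ≫ b ∈ ghostPow (p + q + 1) K M
    rw [← Category.assoc]
    exact comp_mem_ghostPow_succ (hq hf ha) hb

/-- The composites with `c.i` of elements of `ghostPow p` already form a subgroup, so it suffices to
lift generators. -/
lemma GhostCover.exists_lift_of_mem_ghostPow {K L : DerivedCategory C} (c : L.GhostCover)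
    {p : ℕ} {f : K ⟶ L} (hf : f ∈ ghostPow (p + 1) K L) :
    ∃ g ∈ ghostPow p K c.obj, g ≫ c.i = f := by
  refine ghostPow_succ_le ((ghostPow p K c.obj).map (Preadditive.rightComp K c.i))
    (fun M g h hg hh ↦ ?_) hf
  obtain ⟨h', rfl⟩ := c.exists_lift h hh
  exact ⟨g ≫ h', comp_mem_ghostPow_right h' hg, Category.assoc _ _ _⟩

/-! ### Iterated covers and Ext classes -/

open Abelian in
/-- The object `P` classifies the composites of `p` ghosts with target `L`. -/
lemma exists_ghostPow_cover [EnoughInjectives C] [HasExt.{w'} C] (p : ℕ) :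
    ∀ (L : DerivedCategory C), ∃ (P : DerivedCategory C) (i : P ⟶ L),
      i ∈ ghostPow p P L ∧
      (∀ (K : DerivedCategory C) (f : K ⟶ L), f ∈ ghostPow p K L → ∃ g, g ≫ i = f) ∧
      (∀ n₀ n₁ : ℤ, n₀ + p = n₁ → IsZero ((homologyFunctor C n₀).obj L) →
        IsZero ((homologyFunctor C n₁).obj P)) ∧
      ∃ κ : ∀ n₀ n₁ : ℤ, n₀ + p = n₁ →
        Ext.{w'} ((homologyFunctor C n₁).obj P) ((homologyFunctor C n₀).obj L) p,
        ∀ (K : DerivedCategory C) (x : K ⟶ P),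
          (∀ (n₀ n₁ : ℤ) (h : n₀ + p = n₁),
            (Ext.mk₀ ((homologyFunctor C n₁).map x)).comp (κ n₀ n₁ h) (zero_add p) = 0) →
          x ≫ i ∈ ghostPow (p + 1) K L := by
  obtain _ | p := p
  · intro L
    refine ⟨L, 𝟙 L, mem_ghostPow_zero _, fun K f _ ↦ ⟨f, Category.comp_id f⟩, ?_, ?_⟩
    · intro n₀ n₁ h hL
      obtain rfl : n₀ = n₁ := by simpa using h
      exact hL
    · refine ⟨fun n₀ n₁ h ↦ Ext.mk₀ (eqToHom (by simp at h; rw [h])), fun K x hx ↦ ?_⟩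
      rw [Category.comp_id, mem_ghostPow_one_iff]
      intro n
      simpa [Ext.mk₀_comp_mk₀, Ext.mk₀_eq_zero_iff] using hx n n (by simp)
  -- The case of one ghost is separate: the inductive step kills Ext into an injective, which
  -- requires positive degree.
  · induction p with
    | zero =>
      intro L
      obtain ⟨c⟩ := nonempty_ghostCover L
      refine ⟨c.obj, c.i, (mem_ghostPow_one_iff _).2 c.isGhost_i, fun K f hf ↦
        c.exists_lift f ((mem_ghostPow_one_iff f).1 hf),
        fun n₀ n₁ h ↦ c.isZero n₀ n₁ (by simpa using h),
        fun n₀ n₁ h ↦ (c.shortExact n₀ n₁ (by simpa using h)).extClass, fun K x hx ↦ ?_⟩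
      -- Vanishing of the classes lifts each H^n(x) to `c.E`. A morphism `y` realises these lifts,
      -- and `x - y ≫ c.a` is a ghost with the same composite to `L`.
      have h (n : ℤ) : ∃ α : (homologyFunctor C n).obj K ⟶ (homologyFunctor C n).obj c.E,
          α ≫ (homologyFunctor C n).map c.a = (homologyFunctor C n).map x := by
        obtain ⟨y, hy⟩ := Ext.covariant_sequence_exact₃ _
          (c.shortExact (n - 1) n (by lia)) _ _ (hx (n - 1) n (by simp))
        obtain ⟨α, rfl⟩ := Ext.addEquiv₀.symm.surjective y
        refine ⟨α, Ext.addEquiv₀.symm.injective ?_⟩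
        simpa [Ext.mk₀_comp_mk₀] using hy
      choose α hα using h
      obtain ⟨y, hy⟩ := c.isSplitInjective.exists_homology_map_eq α
      have hxy : IsGhost (x - y ≫ c.a) := fun n ↦ by
        rw [Functor.map_sub, Functor.map_comp, hy, hα, sub_self]
      have : x ≫ c.i = (x - y ≫ c.a) ≫ c.i := by
        rw [Preadditive.sub_comp, Category.assoc, c.a_i, comp_zero, sub_zero]
      rw [this]
      exact comp_mem_ghostPow_succ ((mem_ghostPow_one_iff _).2 hxy) c.isGhost_i
    | succ p hp =>
      intro L
      obtain ⟨c⟩ := nonempty_ghostCover L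
      obtain ⟨P, i, hi, hlift, hz, κ, hκ⟩ := hp c.obj
      refine ⟨P, i ≫ c.i, comp_mem_ghostPow_succ hi c.isGhost_i, fun K f hf ↦ ?_,
        fun n₀ n₁ h hL ↦ hz (n₀ + 1) n₁ (by push_cast at h ⊢; lia) (c.isZero n₀ _ rfl hL),
        fun n₀ n₁ h ↦ (κ (n₀ + 1) n₁ (by push_cast at h ⊢; lia)).comp
          (c.shortExact n₀ (n₀ + 1) rfl).extClass rfl, fun K x hx ↦ ?_⟩
      · obtain ⟨g, hg, rfl⟩ := c.exists_lift_of_mem_ghostPow hf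
        obtain ⟨g', rfl⟩ := hlift K g hg
        exact ⟨g', (Category.assoc _ _ _).symm⟩
      · rw [← Category.assoc]
        refine comp_mem_ghostPow_succ (hκ K x fun n₀ n₁ h ↦ ?_) c.isGhost_i
        obtain ⟨n, rfl⟩ : ∃ n, n₀ = n + 1 := ⟨n₀ - 1, by simp⟩
        have h' := hx n n₁ (by push_cast at h ⊢; lia)
        rw [← Ext.comp_assoc _ _ _ (zero_add (p + 1)) rfl (by lia)] at h'
        -- The pullback of `κ` comes from Ext^{p+1} into the injective H^{n+1}(`c.E`), which is
        -- zero.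
        obtain ⟨y, hy⟩ := Ext.covariant_sequence_exact₃ _ (c.shortExact n (n + 1) rfl) _ _ h'
        have := c.isSplitInjective.injective_homology (n + 1)
        rw [← hy, Ext.eq_zero_of_injective y, Ext.zero_comp]

end DerivedCategory

lemma IsAddSubquotient.of_surjective {A G H : Type*} [AddCommGroup A] [AddCommGroup G]
    [AddCommGroup H] (π : A →+ G) (hπ : Function.Surjective π) (θ : A →+ H)
    (h : θ.ker ≤ π.ker) : IsAddSubquotient G H := by
  let ψ : θ.range →+ G :=
    (QuotientAddGroup.lift θ.ker π h).comp
      (QuotientAddGroup.quotientKerEquivRange θ).symm.toAddMonoidHom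
  have hψ : Function.Surjective ψ := by
    intro g
    obtain ⟨a, rfl⟩ := hπ g
    exact ⟨QuotientAddGroup.quotientKerEquivRange θ a, by simp [ψ]⟩
  exact ⟨θ.range, ψ.ker, ⟨(QuotientAddGroup.quotientKerEquivOfSurjective ψ hψ).symm⟩⟩

/-! ### Graded pieces, vanishing and naturality -/

namespace DerivedCategory

open Limits Abelian

variable {C : Type u} [Category.{v} C] [Abelian C] [HasDerivedCategory.{w} C]

lemma isAddSubquotient_ghostPow [EnoughInjectives C] [HasExt.{w'} C]
    (K L : DerivedCategory C) (p : ℕ) :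
    IsAddSubquotient
      (ghostPow p K L ⧸ (ghostPow (p + 1) K L).addSubgroupOf (ghostPow p K L))
      (∀ n : ℤ, Ext.{w'} ((homologyFunctor C n).obj K) ((homologyFunctor C (n - p)).obj L) p) := by
  obtain ⟨P, i, hi, hlift, -, κ, hκ⟩ := exists_ghostPow_cover.{w'} p L
  let ρ : (K ⟶ P) →+ ghostPow p K L :=
    (Preadditive.rightComp K i).codRestrict _ fun x ↦ comp_mem_ghostPow_left x hi
  let θ : (K ⟶ P) →+
      ∀ n : ℤ, Ext.{w'} ((homologyFunctor C n).obj K) ((homologyFunctor C (n - p)).obj L) p :=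
    { toFun x n := (Ext.mk₀ ((homologyFunctor C n).map x)).comp
        (κ (n - p) n (by simp)) (zero_add p)
      map_zero' := by ext n; simp
      map_add' x y := by ext n; simp [Ext.mk₀_add] }
  refine IsAddSubquotient.of_surjective ((QuotientAddGroup.mk' _).comp ρ)
    ((QuotientAddGroup.mk'_surjective _).comp ?_) θ fun x hx ↦ ?_
  · rintro ⟨f, hf⟩
    obtain ⟨g, rfl⟩ := hlift K f hf
    exact ⟨g, rfl⟩
  · rw [AddMonoidHom.mem_ker, AddMonoidHom.comp_apply, QuotientAddGroup.mk'_apply,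
      QuotientAddGroup.eq_zero_iff, AddSubgroup.mem_addSubgroupOf]
    refine hκ K x fun n₀ n₁ h ↦ ?_
    obtain rfl : n₀ = n₁ - p := by lia
    exact congr_fun hx n₁

lemma exists_ghostPow_eq_bot [EnoughInjectives C] (K L : Bounded C) :
    ∃ N : ℕ, ∀ p : ℕ, N ≤ p → ghostPow p K.obj L.obj = ⊥ := by
  obtain ⟨-, b, hb⟩ := K.property
  obtain ⟨⟨a, ha⟩, -⟩ := L.property
  have : HasExt.{max u v} C := HasExt.standard C
  -- `P` lives in degrees ≥ a + p and `K` in degrees ≤ b, so there are no nonzero maps once p > b -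
  -- a.
  refine ⟨(b - a + 1).toNat, fun p hp ↦ (AddSubgroup.eq_bot_iff_forall _).2 fun f hf ↦ ?_⟩
  obtain ⟨P, i, -, hlift, hz, -⟩ := exists_ghostPow_cover.{max u v} p L.obj
  obtain ⟨g, rfl⟩ := hlift _ f hf
  have hP : P.IsGE (a + p) := (isGE_iff _ _).2 fun n hn ↦
    hz (n - p) n (by simp) ((isGE_iff _ _).1 ha _ (by lia))
  rw [TStructure.t.zero_of_isLE_of_isGE g b (a + p) (by lia) hb hP, zero_comp]

/-- The `Hom`-functor of the bounded derived category, with the filtration by powers of the ideal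
of ghosts. -/
noncomputable def ghostFiltrationFunctor : (Bounded C)ᵒᵖ × Bounded C ⥤ FilteredAb.{w} where
  obj X :=
    { carrier := X.1.unop.obj ⟶ X.2.obj
      fil p := ghostPow p.toNat _ _
      antitone_fil _ _ h := ghostPow_antitone _ _ (Int.toNat_le_toNat h) }
  map f :=
    { hom := (Preadditive.rightComp _ f.2.hom).comp (Preadditive.leftComp _ f.1.unop.hom)
      map_mem _ _ hx := comp_mem_ghostPow_right _ (comp_mem_ghostPow_left _ hx) }
  map_id X := by
    apply FilteredAb.Hom.ext
    ext x
    exact (Category.comp_id _).trans (Category.id_comp _)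
  map_comp f g := by
    apply FilteredAb.Hom.ext
    ext x
    change ((g.1.unop.hom ≫ f.1.unop.hom) ≫ x) ≫ f.2.hom ≫ g.2.hom =
      (g.1.unop.hom ≫ (f.1.unop.hom ≫ x) ≫ f.2.hom) ≫ g.2.hom
    simp only [Category.assoc]

/-- The functor `ghostFiltrationFunctor` lifts the `Hom`-functor. -/
noncomputable def ghostFiltrationFunctorForgetIso :
    ghostFiltrationFunctor (C := C) ⋙ FilteredAb.forgetFiltration ≅ boundedHomFunctor C :=
  NatIso.ofComponents (fun _ ↦ Iso.refl _) fun {X _} f ↦ by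
    ext (x : X.1.unop.obj ⟶ X.2.obj)
    rfl

lemma homFiltration_ghostFiltrationFunctor (K L : Bounded C) (p : ℤ) :
    homFiltration ghostFiltrationFunctor ghostFiltrationFunctorForgetIso K L p =
      ghostPow p.toNat K.obj L.obj :=
  AddSubgroup.map_id _

end DerivedCategory

open DerivedCategory in
theorem proposition1
    (C : Type u) [Category.{v} C] [Abelian C] [EnoughInjectives C]
    [HasDerivedCategory.{w} C] [HasExt.{w'} C] :
    ∃ (Φ : (DerivedCategory.Bounded C)ᵒᵖ × DerivedCategory.Bounded C ⥤ FilteredAb.{w})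
      (e : Φ ⋙ FilteredAb.forgetFiltration ≅ boundedHomFunctor C),
      -- (1) exhaustive, and eventually zero
      (∀ K L : DerivedCategory.Bounded C,
        homFiltration Φ e K L 0 = ⊤ ∧
          ∃ N : ℤ, ∀ p : ℤ, N ≤ p → homFiltration Φ e K L p = ⊥) ∧
      -- (2) multiplicative under composition
      (∀ (K L M : DerivedCategory.Bounded C) (p q : ℤ) (f : K.obj ⟶ L.obj) (g : L.obj ⟶ M.obj),
        f ∈ homFiltration Φ e K L p → g ∈ homFiltration Φ e L M q →
          f ≫ g ∈ homFiltration Φ e K M (p + q)) ∧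
      -- (3) the graded pieces; in negative degrees `Ext` is zero, so `F^p / F^(p+1)` is zero there
      (∀ (K L : DerivedCategory.Bounded C) (p : ℕ),
        IsAddSubquotient
          (homFiltration Φ e K L p ⧸
            (homFiltration Φ e K L (p + 1)).addSubgroupOf (homFiltration Φ e K L p))
          (∀ n : ℤ, Abelian.Ext.{w'} ((DerivedCategory.homologyFunctor C n).obj K.obj)
            ((DerivedCategory.homologyFunctor C (n - p)).obj L.obj) p)) ∧
      (∀ (K L : DerivedCategory.Bounded C) (p : ℤ), p < 0 →
        homFiltration Φ e K L (p + 1) = homFiltration Φ e K L p) ∧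
      -- (4) the first step consists of the morphisms that are zero on cohomology
      (∀ (K L : DerivedCategory.Bounded C) (φ : K.obj ⟶ L.obj),
        φ ∈ homFiltration Φ e K L 1 ↔
          ∀ n : ℤ, (DerivedCategory.homologyFunctor C n).map φ = 0) := by
  refine ⟨ghostFiltrationFunctor, ghostFiltrationFunctorForgetIso, ?_⟩
  simp only [homFiltration_ghostFiltrationFunctor]
  refine ⟨fun K L ↦ ⟨rfl, ?_⟩, fun K L M p q f g hf hg ↦ ?_, fun K L p ↦ ?_, fun K L p hp ↦ ?_,
    fun K L φ ↦ mem_ghostPow_one_iff φ⟩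
  · obtain ⟨N, hN⟩ := exists_ghostPow_eq_bot K L
    exact ⟨N, fun p hp ↦ hN _ (by lia)⟩
  · exact ghostPow_antitone _ _ (show (p + q).toNat ≤ p.toNat + q.toNat by lia)
      (comp_mem_ghostPow_add hf hg)
  · rw [homFiltration_ghostFiltrationFunctor K L (p + 1),
      homFiltration_ghostFiltrationFunctor K L p]
    exact isAddSubquotient_ghostPow.{w'} K.obj L.obj p
  · rw [Int.toNat_of_nonpos (show p ≤ 0 by lia), Int.toNat_of_nonpos (show p + 1 ≤ 0 by lia)]
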